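/- **Proposition 2.1.** Let $X$ be a noetherian scheme satisfying Serre's condition $S_2$, i.e. $\operatorname{depth}\mathcal O_{X,x}\ge\min(2,\dim\mathcal O_{X,x})$ for every $x\in X$. Let $\mathcal K_X$ be the sheaf of total quotient rings of $X$. An *effective generalized divisor* on $X$ is a coherent $\mathcal O_X$-submodule $\mathcal I\subseteq\mathcal K_X$ such that $\mathcal I\subseteq\mathcal O_X$; $\mathcal I$ is nondegenerate, i.e. $\mathcal I_\eta=\mathcal K_{X,\eta}$ for every generic point $\eta$ of $X$; and $\mathcal I$ satisfies $S_2$, i.e. $\operatorname{depth}\mathcal I_x\ge\min(2,\dim\mathcal O_{X,x})$ for every $x\in X$. Then $Y\mapsto\mathcal I_Y=\ker(\mathcal O_X\to\mathcal O_Y)$ is a bijection from the set of closed subschemes $Y\subseteq X$ of pure codimension one with no embedded points onto the set of effective generalized divisors on $X$. Here *pure codimension one* means that every irreducible component of $Y$ has codimension one in $X$, and *no embedded points* means that every associated point of $Y$ is the generic point of an irreducible component of $Y$; the empty subscheme is included and corresponds to $\mathcal I=\mathcal O_X$. -/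

import Mathlib

open CategoryTheory AlgebraicGeometry TopologicalSpace Opposite

universe u

namespace GenDiv

section Algebra

/-- The depth of a module `M` over a local ring `R`: the supremum of the lengths of the sequences
in the maximal ideal which are regular on `M`. The clause `M ≠ (r₁, …, rₙ)M` is left out of
regularity: for a nonzero finitely generated module it is automatic (Nakayama), and the zero
module gets depth `∞`, which is the usual convention. -/
noncomputable def depth (R M : Type u) [CommRing R] [IsLocalRing R] [AddCommGroup M] [Module R M] :
    ℕ∞ :=
  ⨆ (rs : List R) (_ : (∀ r ∈ rs, r ∈ IsLocalRing.maximalIdeal R) ∧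
    RingTheory.Sequence.IsWeaklyRegular M rs), (rs.length : ℕ∞)

/-- The inequality `depth M ≥ min (k, dim R)` over a local ring `R`. -/
def DepthGeMin (k : ℕ) (R M : Type u) [CommRing R] [IsLocalRing R] [AddCommGroup M] [Module R M] :
    Prop :=
  min (k : WithBot ℕ∞) (ringKrullDim R) ≤ ((depth R M : ℕ∞) : WithBot ℕ∞)

end Algebra

/-- The scheme `X` satisfies Serre's condition `S_k`:
`depth 𝒪_{X,x} ≥ min (k, dim 𝒪_{X,x})` at every point `x`. -/
def SatisfiesSerre (X : Scheme.{u}) (k : ℕ) : Prop :=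
  ∀ x : X, DepthGeMin k (X.presheaf.stalk x) (X.presheaf.stalk x)

section TotalQuotient

variable (X : Scheme.{u})

/-- The sheaf `𝒦_X` of total quotient rings of `X`: the sheaf associated with the presheaf
`U ↦ S(U)⁻¹ 𝒪_X(U)`, where `S(U)` is the set of the sections over `U` which are nonzerodivisors in
every stalk `𝒪_{X,x}`, `x ∈ U`. -/
noncomputable def totalQuotientSheaf : TopCat.Sheaf CommRingCat.{u} X :=
  (presheafToSheaf (Opens.grothendieckTopology X) CommRingCat.{u}).obj
    (TopCat.Presheaf.totalQuotientPresheaf X.presheaf)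

/-- The canonical homomorphism `𝒪_X ⟶ 𝒦_X`. -/
noncomputable def toTotalQuotientSheaf : X.presheaf ⟶ (totalQuotientSheaf X).presheaf :=
  TopCat.Presheaf.toTotalQuotientPresheaf X.presheaf ≫
    toSheafify (Opens.grothendieckTopology X) (TopCat.Presheaf.totalQuotientPresheaf X.presheaf)

/-- The ring `𝒦_X(U)`. -/
abbrev KSec (U : X.Opens) : Type u := (totalQuotientSheaf X).presheaf.obj (op U)

/-- The stalk `𝒦_{X,x}`. -/
abbrev KStalk (x : X) : Type u := (totalQuotientSheaf X).presheaf.stalk x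

variable {X}

/-- `𝒪_X(U) → 𝒦_X(U)`. -/
noncomputable def toK (U : X.Opens) : Γ(X, U) →+* KSec X U :=
  ((toTotalQuotientSheaf X).app (op U)).hom

/-- `𝒪_{X,x} → 𝒦_{X,x}`. -/
noncomputable def toKStalk (x : X) : X.presheaf.stalk x →+* KStalk X x :=
  ((TopCat.Presheaf.stalkFunctor CommRingCat.{u} x).map (toTotalQuotientSheaf X)).hom

noncomputable instance (U : X.Opens) : Algebra Γ(X, U) (KSec X U) := (toK U).toAlgebra

noncomputable instance (x : X) : Algebra (X.presheaf.stalk x) (KStalk X x) :=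
  (toKStalk x).toAlgebra

/-- Restriction of sections of `𝒦_X`. -/
noncomputable def resK {U V : X.Opens} (h : V ≤ U) : KSec X U →+* KSec X V :=
  ((totalQuotientSheaf X).presheaf.map (homOfLE h).op).hom

/-- Restriction of sections of `𝒪_X`. -/
noncomputable def resO {U V : X.Opens} (h : V ≤ U) : Γ(X, U) →+* Γ(X, V) :=
  (X.presheaf.map (homOfLE h).op).hom

/-- The germ of a section of `𝒦_X`. -/
noncomputable def germK (U : X.Opens) (x : X) (hx : x ∈ U) : KSec X U →+* KStalk X x :=
  ((totalQuotientSheaf X).presheaf.germ U x hx).hom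

lemma resK_resK {U V W : X.Opens} (h : V ≤ U) (h' : W ≤ V) (s : KSec X U) :
    resK h' (resK h s) = resK (h'.trans h) s := by
  have := (totalQuotientSheaf X).presheaf.map_comp (homOfLE h).op (homOfLE h').op
  exact (congrArg (fun f => f.hom s) this).symm

lemma resK_toK {U V : X.Opens} (h : V ≤ U) (a : Γ(X, U)) :
    resK h (toK U a) = toK V (resO h a) := by
  have := (toTotalQuotientSheaf X).naturality (homOfLE h).op
  exact (congrArg (fun f => f.hom a) this).symm

lemma resK_smul {U V : X.Opens} (h : V ≤ U) (a : Γ(X, U)) (s : KSec X U) :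
    resK h (a • s) = resO h a • resK h s := by
  rw [Algebra.smul_def, Algebra.smul_def, map_mul]
  exact congrArg (· * _) (resK_toK h a)

lemma germK_resK {U V : X.Opens} (h : V ≤ U) (x : X) (hx : x ∈ V) (s : KSec X U) :
    germK V x hx (resK h s) = germK U x (h hx) s :=
  (totalQuotientSheaf X).presheaf.germ_res_apply (homOfLE h) x hx s

lemma germK_smul (U : X.Opens) (x : X) (hx : x ∈ U) (a : Γ(X, U)) (s : KSec X U) :
    germK U x hx (a • s) = (X.presheaf.germ U x hx).hom a • germK U x hx s := by
  rw [Algebra.smul_def, Algebra.smul_def, map_mul]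
  refine congrArg (· * _) ?_
  exact (TopCat.Presheaf.stalkFunctor_map_germ_apply U x hx (toTotalQuotientSheaf X) a).symm

end TotalQuotient

/-- An `𝒪_X`-submodule (subsheaf of `𝒪_X`-modules) of `𝒦_X`. -/
@[ext]
structure KSubmodule (X : Scheme.{u}) where
  /-- the sections over an open set -/
  sec : ∀ U : X.Opens, Submodule Γ(X, U) (KSec X U)
  res_mem : ∀ {U V : X.Opens} (h : V ≤ U) {s : KSec X U}, s ∈ sec U → resK h s ∈ sec V
  mem_of_locally : ∀ {U : X.Opens} (s : KSec X U),
    (∀ x ∈ U, ∃ (V : X.Opens) (h : V ≤ U), x ∈ V ∧ resK h s ∈ sec V) → s ∈ sec U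

namespace KSubmodule

variable {X : Scheme.{u}}

/-- The stalk `ℐ_x` as an `𝒪_{X,x}`-submodule of `𝒦_{X,x}`. -/
def stalk (I : KSubmodule X) (x : X) : Submodule (X.presheaf.stalk x) (KStalk X x) where
  carrier := {t | ∃ (U : X.Opens) (hx : x ∈ U), ∃ s ∈ I.sec U, germK U x hx s = t}
  zero_mem' := ⟨⊤, trivial, 0, zero_mem _, map_zero _⟩
  add_mem' := by
    rintro _ _ ⟨U, hU, s, hs, rfl⟩ ⟨V, hV, t, ht, rfl⟩
    refine ⟨U ⊓ V, ⟨hU, hV⟩, resK inf_le_left s + resK inf_le_right t,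
      add_mem (I.res_mem _ hs) (I.res_mem _ ht), ?_⟩
    rw [map_add]
    have hx : x ∈ U ⊓ V := ⟨hU, hV⟩
    exact congrArg₂ (· + ·) (germK_resK _ x hx s) (germK_resK _ x hx t)
  smul_mem' := by
    rintro c _ ⟨V, hV, t, ht, rfl⟩
    obtain ⟨U, hU, a, rfl⟩ := X.presheaf.exists_germ_eq c
    refine ⟨U ⊓ V, ⟨hU, hV⟩, resO inf_le_left a • resK inf_le_right t,
      (I.sec _).smul_mem _ (I.res_mem _ ht), ?_⟩
    have hx : x ∈ U ⊓ V := ⟨hU, hV⟩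
    refine (germK_smul _ x hx _ _).trans ?_
    refine congrArg₂ (· • ·) ?_ (germK_resK _ x hx t)
    exact X.presheaf.germ_res_apply (homOfLE inf_le_left) x hx a

/-- Coherence on a locally noetherian scheme: on every affine open `U` the module `ℐ(U)` is finitely
generated over `𝒪_X(U)` and `ℐ|_U` is the sheaf associated with it, that is, `ℐ(D(f))` is the
localization `ℐ(U)_f` (by the restriction map) for every `f ∈ 𝒪_X(U)`. -/
structure IsCoherent (I : KSubmodule X) : Prop where
  finite : ∀ U : X.affineOpens, Module.Finite Γ(X, U.1) (I.sec U.1)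
  exists_of_basicOpen : ∀ (U : X.affineOpens) (f : Γ(X, U.1)), ∀ s ∈ I.sec (X.basicOpen f),
    ∃ n : ℕ, ∃ t ∈ I.sec U.1, resK (X.basicOpen_le f) t = resO (X.basicOpen_le f) f ^ n • s
  eq_zero_of_basicOpen : ∀ (U : X.affineOpens) (f : Γ(X, U.1)), ∀ t ∈ I.sec U.1,
    resK (X.basicOpen_le f) t = 0 → ∃ n : ℕ, f ^ n • t = 0

/-- `ℐ_η = 𝒦_{X,η}` for every generic point `η` of (an irreducible component of) `X`. -/
def IsNondegenerate (I : KSubmodule X) : Prop :=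
  ∀ η ∈ genericPoints X, I.stalk η = ⊤

/-- Serre's condition `S_k` for the sheaf of `𝒪_X`-modules `ℐ`:
`depth ℐ_x ≥ min (k, dim 𝒪_{X,x})` at every point `x`. -/
def SatisfiesSerre (I : KSubmodule X) (k : ℕ) : Prop :=
  ∀ x : X, DepthGeMin k (X.presheaf.stalk x) (I.stalk x)

/-- The ideal of a generalized divisor: a fractional ideal (coherent `𝒪_X`-submodule of `𝒦_X`) which
is nondegenerate and satisfies `S_2`. -/
structure IsGeneralizedDivisor (I : KSubmodule X) : Prop where
  coherent : I.IsCoherent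
  nondegenerate : I.IsNondegenerate
  serre : I.SatisfiesSerre 2

/-- The image in `𝒦_X` of a presheaf of ideals `J ⊆ 𝒪_X`: the sections of `𝒦_X` which are locally
images of sections of `J`. -/
def ofIdeals (J : ∀ U : X.Opens, Ideal Γ(X, U))
    (hJ : ∀ {U V : X.Opens} (h : V ≤ U) {a : Γ(X, U)}, a ∈ J U → resO h a ∈ J V) :
    KSubmodule X where
  sec U :=
    { carrier := {s | ∀ x ∈ U, ∃ (V : X.Opens) (h : V ≤ U), x ∈ V ∧ ∃ a ∈ J V, toK V a = resK h s}
      zero_mem' := fun x hx => ⟨U, le_rfl, hx, 0, zero_mem _, by simp⟩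
      add_mem' := by
        intro s t hs ht x hx
        obtain ⟨V, hV, hxV, a, ha, has⟩ := hs x hx
        obtain ⟨W, hW, hxW, b, hb, hbt⟩ := ht x hx
        refine ⟨V ⊓ W, inf_le_left.trans hV, ⟨hxV, hxW⟩, resO inf_le_left a + resO inf_le_right b,
          add_mem (hJ _ ha) (hJ _ hb), ?_⟩
        rw [map_add, map_add, ← resK_toK, ← resK_toK, has, hbt, resK_resK, resK_resK]
      smul_mem' := by
        intro c s hs x hx
        obtain ⟨V, hV, hxV, a, ha, has⟩ := hs x hx
        refine ⟨V, hV, hxV, resO hV c * a, Ideal.mul_mem_left _ _ ha, ?_⟩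
        rw [map_mul, has, resK_smul, Algebra.smul_def]
        rfl }
  res_mem := by
    intro U V h s hs x hx
    obtain ⟨W, hW, hxW, a, ha, has⟩ := hs x (h hx)
    refine ⟨V ⊓ W, inf_le_left, ⟨hx, hxW⟩, resO inf_le_right a, hJ _ ha, ?_⟩
    rw [← resK_toK, has, resK_resK, resK_resK]
  mem_of_locally := by
    intro U s hs x hx
    obtain ⟨V, hV, hxV, hsV⟩ := hs x hx
    obtain ⟨W, hW, hxW, a, ha, has⟩ := hsV x hxV
    exact ⟨W, hW.trans hV, hxW, a, ha, by rw [has, resK_resK]⟩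

/-- `𝒪_X` as a submodule of `𝒦_X`. -/
def structureSheaf (X : Scheme.{u}) : KSubmodule X :=
  ofIdeals (fun _ => ⊤) (fun _ _ _ => Submodule.mem_top)

/-- `ℐ ⊆ 𝒪_X`. -/
def IsEffective (I : KSubmodule X) : Prop :=
  ∀ U : X.Opens, I.sec U ≤ (structureSheaf X).sec U

/-- The ideal sheaf of a morphism `i : Y ⟶ X` (in practice a closed immersion), that is, the kernel
of `𝒪_X ⟶ i_* 𝒪_Y`, as a submodule of `𝒦_X`. -/
noncomputable def ofHom {Y : Scheme.{u}} (i : Y ⟶ X) : KSubmodule X :=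
  ofIdeals (fun U => RingHom.ker (i.app U).hom) <| by
    intro U V h a ha
    rw [RingHom.mem_ker] at ha ⊢
    have := i.naturality (homOfLE h).op
    refine (congrArg (fun f => f.hom a) this).trans ?_
    simp [ha]

lemma ofHom_comp_iso {Y Z : Scheme.{u}} (e : Z ≅ Y) (i : Y ⟶ X) :
    ofHom (e.hom ≫ i) = ofHom i := by
  have : ∀ U : X.Opens, RingHom.ker ((e.hom ≫ i).app U).hom = RingHom.ker (i.app U).hom := by
    intro U
    ext a
    rw [RingHom.mem_ker, RingHom.mem_ker, Scheme.Hom.comp_app]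
    change (e.hom.app (i ⁻¹ᵁ U)).hom ((i.app U).hom a) = 0 ↔ _
    exact map_eq_zero_iff _ ((ConcreteCategory.bijective_of_isIso (e.hom.app (i ⁻¹ᵁ U))).1)
  unfold ofHom
  congr 1
  funext U
  exact this U

end KSubmodule

/-- `y` is an associated point of `Y`: the maximal ideal of `𝒪_{Y,y}` is an associated prime of
`𝒪_{Y,y}`. -/
def IsAssociatedPoint (Y : Scheme.{u}) (y : Y) : Prop :=
  IsAssociatedPrime (IsLocalRing.maximalIdeal (Y.presheaf.stalk y)) (Y.presheaf.stalk y)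

/-- `Y` has no embedded points: every associated point of `Y` is the generic point of an irreducible
component of `Y`. -/
def HasNoEmbeddedPoints (Y : Scheme.{u}) : Prop :=
  ∀ y : Y, IsAssociatedPoint Y y → y ∈ genericPoints Y

/-- The image of `i : Y ⟶ X` has pure codimension one: for the generic point `y` of each irreducible
component of `Y`, the closure of `i y` has codimension one in `X`. (`Order.coheight x` is the
supremum of the lengths of the chains of generizations of `x`, that is, the codimension of the
closure of `x`.) The empty subscheme is included. -/
def IsPureCodimOne {X Y : Scheme.{u}} (i : Y ⟶ X) : Prop :=
  ∀ y ∈ genericPoints Y, Order.coheight (i y) = 1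

/-- A closed immersion into `X`. -/
structure ClosedImmersionInto (X : Scheme.{u}) where
  /-- the source -/
  source : Scheme.{u}
  /-- the morphism -/
  hom : source ⟶ X
  isClosedImmersion : IsClosedImmersion hom

/-- Two closed immersions `Y ⟶ X` and `Z ⟶ X` are equivalent if there is an isomorphism `Y ≅ Z`
over `X`. -/
instance closedImmersionSetoid (X : Scheme.{u}) : Setoid (ClosedImmersionInto X) where
  r Y Z := ∃ e : Y.source ≅ Z.source, e.hom ≫ Z.hom = Y.hom
  iseqv :=
    { refl := fun Y => ⟨Iso.refl _, Category.id_comp _⟩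
      symm := by
        rintro Y Z ⟨e, he⟩
        exact ⟨e.symm, by rw [Iso.symm_hom, Iso.inv_comp_eq, he]⟩
      trans := by
        rintro Y Z W ⟨e, he⟩ ⟨f, hf⟩
        exact ⟨e ≪≫ f, by rw [Iso.trans_hom, Category.assoc, hf, he]⟩ }

/-- A closed subscheme of `X`: an equivalence class of closed immersions into `X`. -/
def ClosedSubscheme (X : Scheme.{u}) : Type (u + 1) :=
  _root_.Quotient (closedImmersionSetoid X)

namespace ClosedSubscheme

variable {X : Scheme.{u}}

/-- The ideal sheaf of a closed subscheme, as a submodule of `𝒦_X`. -/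
noncomputable def idealSheaf : ClosedSubscheme X → KSubmodule X :=
  _root_.Quotient.lift (fun Y => KSubmodule.ofHom Y.hom) <| by
    rintro Y Z ⟨e, he⟩
    rw [← he]
    exact KSubmodule.ofHom_comp_iso _ _

/-- The closed subscheme (any, equivalently some, closed immersion representing it) is of pure
codimension one in `X` and has no embedded points. -/
def IsPureCodimOneNoEmbedded (Y : ClosedSubscheme X) : Prop :=
  ∃ Z : ClosedImmersionInto X,
    _root_.Quotient.mk (closedImmersionSetoid X) Z = Y ∧
      IsPureCodimOne Z.hom ∧ HasNoEmbeddedPoints Z.source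

end ClosedSubscheme

end GenDiv

/-! Since `𝒪_X` embeds in `𝒦_X` (`toK_injective`), effective coherent submodules of `𝒦_X` are the
coherent ideal sheaves, hence correspond to closed subschemes. It remains to match the conditions on
`ℐ` with those on `Y`.

Let `A = 𝒪_{X,x}` and let `J` be the stalk of the ideal. If `dim A ≥ 2`, then `A` has depth at least
2 by `S_2`, and the sequence `0 → J → A → A/J → 0` shows that `J` has depth at least 2 exactly when
no nonzero element of `A/J` is killed by the maximal ideal (`mem_of_two_le_depth`,
`two_le_depth_ideal`). By `isAssociatedPoint_iff` this says that `x` is not an associated point of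
`Y`. In dimension 1 the depth condition on `J` is inherited from `A`. So `S_2` for `ℐ` means that no
associated point of `Y` has codimension at least 2 in `X`.

Nondegeneracy means that `Y` contains no generic point of `X`, because `𝒪_X` and `𝒦_X` agree there
(`toKStalk_surjective`). Together, the two conditions put every associated point of `Y` in
codimension exactly 1, which is purity without embedded points. -/

namespace GenDiv

/-! ### Depth at most two over a local ring, and associated primes -/

section Depth

open IsLocalRing RingTheory.Sequence

lemma isWeaklyRegular_pair_iff {R M : Type*} [CommRing R] [AddCommGroup M] [Module R M]
    (a b : R) : IsWeaklyRegular M [a, b] ↔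
    IsSMulRegular M a ∧ ∀ x y : M, b • x = a • y → ∃ z, x = a • z := by
  rw [isWeaklyRegular_cons_iff, isWeaklyRegular_singleton_iff]
  refine and_congr_right fun _ => ?_
  rw [isSMulRegular_iff_right_eq_zero_of_smul]
  have key : ∀ x : M, (Submodule.Quotient.mk x : QuotSMulTop a M) = 0 ↔ ∃ z, x = a • z := by
    intro x
    rw [Submodule.Quotient.mk_eq_zero, Submodule.mem_smul_pointwise_iff_exists]
    simp [eq_comm]
  constructor
  · intro h x y hxy
    refine (key x).mp (h _ ?_)
    rw [← Submodule.Quotient.mk_smul]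
    exact (key _).mpr ⟨y, hxy⟩
  · intro h x
    obtain ⟨x, rfl⟩ := Submodule.Quotient.mk_surjective _ x
    intro hx
    rw [← Submodule.Quotient.mk_smul] at hx
    obtain ⟨y, hy⟩ := (key _).mp hx
    exact (key x).mpr (h x y hy)

variable {R M N : Type u} [CommRing R] [IsLocalRing R] [AddCommGroup M] [Module R M]
  [AddCommGroup N] [Module R N]

/-- A prefix of a weakly regular sequence is weakly regular, so every finite bound below the
supremum is attained by a sequence of exactly that length, even when the depth is infinite. -/
lemma le_depth_iff (n : ℕ) : (n : ℕ∞) ≤ depth R M ↔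
    ∃ rs : List R, rs.length = n ∧ (∀ r ∈ rs, r ∈ maximalIdeal R) ∧ IsWeaklyRegular M rs := by
  constructor
  · intro h
    obtain rfl | hn := Nat.eq_zero_or_pos n
    · exact ⟨[], rfl, by simp, .nil R M⟩
    · obtain ⟨k, rfl⟩ : ∃ k, n = k + 1 := ⟨n - 1, by omega⟩
      have h' : (k : ℕ∞) < depth R M := lt_of_lt_of_le (by exact_mod_cast Nat.lt_succ_self k) h
      obtain ⟨rs, hrs⟩ := lt_iSup_iff.mp h'
      obtain ⟨⟨hm, hr⟩, hlt⟩ := lt_iSup_iff.mp hrs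
      have hlen : k + 1 ≤ rs.length := by exact_mod_cast Nat.succ_le_of_lt (by exact_mod_cast hlt)
      refine ⟨rs.take (k + 1), by simp [hlen], fun r h => hm r (List.mem_of_mem_take h), ?_⟩
      rw [← List.take_append_drop (k + 1) rs] at hr
      exact ((isWeaklyRegular_append_iff _ _ _).mp hr).1
  · rintro ⟨rs, rfl, h⟩
    exact le_iSup₂_of_le (f := fun (rs : List R) (_ : (∀ r ∈ rs, r ∈ maximalIdeal R) ∧
      IsWeaklyRegular M rs) => (rs.length : ℕ∞)) rs h le_rfl

lemma one_le_depth_iff : 1 ≤ depth R M ↔ ∃ a ∈ maximalIdeal R, IsSMulRegular M a := by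
  refine (le_depth_iff 1).trans ⟨?_, ?_⟩
  · rintro ⟨rs, h, hm, hr⟩
    obtain ⟨a, rfl⟩ := List.length_eq_one_iff.mp h
    exact ⟨a, hm a (by simp), (isWeaklyRegular_singleton_iff M a).mp hr⟩
  · rintro ⟨a, ha, h⟩
    exact ⟨[a], rfl, by simpa using ha, (isWeaklyRegular_singleton_iff M a).mpr h⟩

lemma two_le_depth_iff : 2 ≤ depth R M ↔ ∃ a ∈ maximalIdeal R, ∃ b ∈ maximalIdeal R,
    IsSMulRegular M a ∧ ∀ x y : M, b • x = a • y → ∃ z, x = a • z := by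
  refine (le_depth_iff 2).trans ⟨?_, ?_⟩
  · rintro ⟨rs, h, hm, hr⟩
    obtain ⟨a, b, rfl⟩ := List.length_eq_two.mp h
    exact ⟨a, hm a (by simp), b, hm b (by simp), (isWeaklyRegular_pair_iff a b).mp hr⟩
  · rintro ⟨a, ha, b, hb, h⟩
    exact ⟨[a, b], rfl, by simpa using ⟨ha, hb⟩, (isWeaklyRegular_pair_iff a b).mpr h⟩

lemma depth_congr (e : M ≃ₗ[R] N) : depth R M = depth R N := by
  unfold depth
  simp_rw [e.isWeaklyRegular_congr]

lemma depthGeMin_congr (k : ℕ) (e : M ≃ₗ[R] N) : DepthGeMin k R M ↔ DepthGeMin k R N := by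
  unfold DepthGeMin
  rw [depth_congr e]

lemma depthGeMin_two_of_dim_eq (d : ℕ∞) (hd : ringKrullDim R = d) :
    DepthGeMin 2 R M ↔ (1 ≤ d → 1 ≤ depth R M) ∧ (2 ≤ d → 2 ≤ depth R M) := by
  unfold DepthGeMin
  rw [hd]
  have : min ((2 : ℕ) : WithBot ℕ∞) (d : WithBot ℕ∞) ≤ (depth R M : WithBot ℕ∞) ↔
      min 2 d ≤ depth R M := by
    rw [← WithBot.coe_le_coe (a := min 2 d)]
    push_cast
    rfl
  rw [this]
  generalize depth R M = e
  constructor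
  · intro h
    exact ⟨fun h1 => le_trans (le_min (by norm_num) h1) h, fun h2 => le_trans (le_min le_rfl h2) h⟩
  · rintro ⟨h1, h2⟩
    by_cases hd2 : 2 ≤ d
    · exact (min_le_left _ _).trans (h2 hd2)
    · refine (min_le_right _ _).trans ?_
      have hd2 : d < 2 := not_le.mp hd2
      by_cases hd1 : 1 ≤ d
      · have hle : d ≤ 1 := (ENat.lt_natCast_add_one_iff (m := d) (n := 1)).mp
          (by simpa [one_add_one_eq_two] using hd2)
        exact hle.trans (h1 hd1)
      · rw [Order.lt_one_iff.mp (not_le.mp hd1)]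
        exact zero_le

/-- Prime avoidance: if no nonzero element is killed by the maximal ideal, then the maximal ideal
contains a nonzerodivisor. -/
lemma exists_isSMulRegular [IsNoetherianRing R] [Module.Finite R M]
    (h : ∀ x : M, (∀ t ∈ maximalIdeal R, t • x = 0) → x = 0) :
    ∃ a ∈ maximalIdeal R, IsSMulRegular M a := by
  by_contra hcon
  push Not at hcon
  have hsub : (maximalIdeal R : Set R) ⊆ ⋃ p ∈ associatedPrimes R M, (p : Set R) := by
    rw [biUnion_associatedPrimes_eq_compl_regular]
    exact fun a ha => hcon a ha
  have hfin : (associatedPrimes R M).Finite := associatedPrimes.finite R M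
  -- The two `⊥` are dummies: prime avoidance tolerates two nonprime ideals, and here all are prime.
  obtain ⟨p, hp, hle⟩ := (Ideal.subset_union_prime_finite hfin (f := id) ⊥ ⊥
    (fun p hp _ _ => IsAssociatedPrime.isPrime hp)).mp hsub
  obtain ⟨hp1, x, hx⟩ := (isAssociatedPrime_iff).mp hp
  have hx0 : x = 0 := h x fun t ht => by
    have := hle ht
    simp only [id] at this
    rw [hx] at this
    simpa using this
  subst hx0
  exact hp1.ne_top (by rw [hx]; simp)

lemma one_le_depth_ideal (h : 1 ≤ depth R R) (J : Ideal R) : 1 ≤ depth R J := by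
  obtain ⟨a, ha, hr⟩ := one_le_depth_iff.mp h
  exact one_le_depth_iff.mpr ⟨a, ha, hr.submodule J a⟩

lemma eq_zero_of_maximalIdeal_mul (h : 1 ≤ depth R R) (x : R)
    (hx : ∀ t ∈ maximalIdeal R, t * x = 0) : x = 0 := by
  obtain ⟨a, ha, hr⟩ := one_le_depth_iff.mp h
  exact hr.right_eq_zero_of_smul (hx a ha)

/-- If `J` has depth at least two and `R` has positive depth, then `R ⧸ J` has no nonzero element
killed by the maximal ideal. -/
lemma mem_of_two_le_depth (hR : 1 ≤ depth R R) {J : Ideal R} (hJ : 2 ≤ depth R J) (e : R)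
    (he : ∀ t ∈ maximalIdeal R, t * e ∈ J) : e ∈ J := by
  obtain ⟨a, ha, b, hb, hr, hab⟩ := two_le_depth_iff.mp hJ
  -- Both `a * e` and `b * e` lie in `J`, and the trivial relation `b(ae) = a(be)` forces `ae = aj`
  -- with `j ∈ J`.
  obtain ⟨⟨j, hj⟩, hz⟩ := hab ⟨a * e, he a ha⟩ ⟨b * e, he b hb⟩ (Subtype.ext (mul_left_comm b a e))
  have hz : a * e = a * j := congrArg Subtype.val hz
  have : e - j = 0 := by
    -- `a` is only known to be regular on `J`, so it cannot be cancelled from `a(e - j) = 0`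
    -- directly; but each `t(e - j)` lies in `J`.
    refine eq_zero_of_maximalIdeal_mul hR _ fun t ht => ?_
    have hmem : t * (e - j) ∈ J := by
      rw [mul_sub]
      exact sub_mem (he t ht) (J.mul_mem_left _ hj)
    have h0 : (⟨_, hmem⟩ : J) = 0 := by
      refine hr.right_eq_zero_of_smul (Subtype.ext ?_)
      change a * (t * (e - j)) = 0
      rw [mul_left_comm, mul_sub, hz, sub_self, mul_zero]
    exact congrArg Subtype.val h0
  rw [sub_eq_zero.mp this]
  exact hj

/-- If `R` has depth at least two and `R ⧸ J` has no nonzero element killed by the maximal ideal,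
then `J` has depth at least two. -/
lemma two_le_depth_ideal [IsNoetherianRing R] (hR : 2 ≤ depth R R) {J : Ideal R}
    (hJ : ∀ e : R, (∀ t ∈ maximalIdeal R, t * e ∈ J) → e ∈ J) : 2 ≤ depth R J := by
  have hR1 : 1 ≤ depth R R := le_trans (by norm_num) hR
  obtain ⟨a₀, ha₀, b₀, hb₀, hr₀, hab₀⟩ := two_le_depth_iff.mp hR
  -- Prime avoidance on the product gives one `a` regular on `R` and on `R ⧸ J` simultaneously.
  obtain ⟨a, ha, hr⟩ := exists_isSMulRegular (R := R) (M := R × (R ⧸ J)) <| by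
    rintro ⟨x, y⟩ h
    obtain ⟨y, rfl⟩ := Ideal.Quotient.mk_surjective y
    refine Prod.ext (eq_zero_of_maximalIdeal_mul hR1 x fun t ht => congrArg Prod.fst (h t ht)) ?_
    refine Ideal.Quotient.eq_zero_iff_mem.mpr (hJ y fun t ht => ?_)
    exact Ideal.Quotient.eq_zero_iff_mem.mp (congrArg Prod.snd (h t ht))
  have hrR : IsSMulRegular R a := by
    refine IsSMulRegular.of_right_eq_zero_of_smul fun x hx => ?_
    exact congrArg Prod.fst (hr.right_eq_zero_of_smul (x := (x, (0 : R ⧸ J)))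
      (Prod.ext hx (smul_zero a)))
  have hrJ : ∀ x, a * x ∈ J → x ∈ J := by
    intro x hx
    refine Ideal.Quotient.eq_zero_iff_mem.mp ?_
    exact congrArg Prod.snd (hr.right_eq_zero_of_smul (x := ((0 : R), Ideal.Quotient.mk J x))
      (Prod.ext (smul_zero a) (Ideal.Quotient.eq_zero_iff_mem.mpr hx)))
  -- Exchange argument: the pair `a₀, b₀` is unrelated to `a`, yet `R ⧸ (a)` still has positive
  -- depth. From `a₀e = af` and `b₀e = ac` one gets `b₀f = a₀c`, so `f = a₀g` and `e = ag`.
  obtain ⟨b, hb, hrb⟩ := exists_isSMulRegular (R := R) (M := R ⧸ Ideal.span {a}) <| by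
    intro e he
    obtain ⟨e, rfl⟩ := Ideal.Quotient.mk_surjective e
    replace he : ∀ t ∈ maximalIdeal R, ∃ c, t * e = a * c := fun t ht =>
      Ideal.mem_span_singleton.mp (Ideal.Quotient.eq_zero_iff_mem.mp (he t ht))
    obtain ⟨f, hf⟩ := he a₀ ha₀
    obtain ⟨c, hc⟩ := he b₀ hb₀
    have hbf : b₀ * f = a₀ * c := hrR <| by
      change a * (b₀ * f) = a * (a₀ * c)
      linear_combination a₀ * hc - b₀ * hf
    obtain ⟨g, hg⟩ := hab₀ f c hbf
    rw [smul_eq_mul] at hg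
    have : e = a * g := hr₀ <| by
      change a₀ * e = a₀ * (a * g)
      rw [hf, hg]; ring
    exact Ideal.Quotient.eq_zero_iff_mem.mpr (Ideal.mem_span_singleton.mpr ⟨g, this⟩)
  refine two_le_depth_iff.mpr ⟨a, ha, b, hb, hrR.submodule J a, ?_⟩
  rintro ⟨x, hx⟩ ⟨y, hy⟩ hxy
  have hxy : b * x = a * y := congrArg Subtype.val hxy
  have : Ideal.Quotient.mk (Ideal.span {a}) x = 0 := hrb.right_eq_zero_of_smul <|
    Ideal.Quotient.eq_zero_iff_mem.mpr (Ideal.mem_span_singleton.mpr ⟨y, hxy⟩)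
  obtain ⟨z, hz⟩ := Ideal.mem_span_singleton.mp (Ideal.Quotient.eq_zero_iff_mem.mp this)
  -- The quotient `z` of `x` by `a` is found in `R`; regularity of `a` on `R ⧸ J` puts it in `J`.
  exact ⟨⟨z, hrJ z (hz ▸ hx)⟩, Subtype.ext hz⟩

lemma isAssociatedPrime_maximalIdeal_iff [IsNoetherianRing R] :
    IsAssociatedPrime (maximalIdeal R) R ↔ ∃ e : R, e ≠ 0 ∧ ∀ t ∈ maximalIdeal R, t * e = 0 := by
  rw [isAssociatedPrime_iff]
  constructor
  · rintro ⟨h, e, he⟩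
    refine ⟨e, ?_, fun t ht => ?_⟩
    · rintro rfl
      exact h.ne_top (by rw [he]; simp)
    · rw [he] at ht
      simpa using ht
  · rintro ⟨e, he0, he⟩
    refine ⟨inferInstance, e, le_antisymm (fun t ht => by simpa using he t ht) ?_⟩
    refine le_maximalIdeal fun htop => he0 ?_
    have : (1 : R) ∈ (⊥ : Submodule R R).colon {e} := by rw [htop]; trivial
    simpa using this

/-- For a surjective local homomorphism, the maximal ideal of the target is an associated prime if
and only if it kills the class of an element outside the kernel. -/
lemma isAssociatedPrime_maximalIdeal_iff_of_surjective {S : Type u} [CommRing S] [IsLocalRing S]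
    [IsNoetherianRing S] (f : R →+* S) [IsLocalHom f] (hf : Function.Surjective f) :
    IsAssociatedPrime (maximalIdeal S) S ↔
      ∃ e ∉ RingHom.ker f, ∀ t ∈ maximalIdeal R, t * e ∈ RingHom.ker f := by
  rw [isAssociatedPrime_maximalIdeal_iff]
  constructor
  · rintro ⟨e, he0, he⟩
    obtain ⟨e, rfl⟩ := hf e
    refine ⟨e, he0, fun t ht => ?_⟩
    rw [RingHom.mem_ker, map_mul]
    exact he _ <| fun hu => ht (isUnit_of_map_unit f t hu)
  · rintro ⟨e, he0, he⟩
    refine ⟨f e, he0, fun t ht => ?_⟩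
    obtain ⟨t, rfl⟩ := hf t
    rw [← map_mul]
    refine he t fun hu => ht (hu.map f)

lemma isAssociatedPrime_maximalIdeal_of_dim_zero [IsNoetherianRing R]
    (h : Ring.KrullDimLE 0 R) : IsAssociatedPrime (maximalIdeal R) R := by
  obtain ⟨p, hp⟩ := associatedPrimes.nonempty R R
  have hprime : p.IsPrime := IsAssociatedPrime.isPrime hp
  rwa [eq_maximalIdeal (Ideal.isMaximal_of_isPrime p), AssociatedPrimes.mem_iff] at hp

end Depth
variable {X : Scheme.{u}}

/-! ### Comparing `𝒪_X` with `𝒦_X` -/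

section Separation

lemma resO_germ {U V : X.Opens} (h : V ≤ U) (x : X) (hx : x ∈ V) (a : Γ(X, U)) :
    (X.presheaf.germ V x hx).hom (resO h a) = (X.presheaf.germ U x (h hx)).hom a :=
  X.presheaf.germ_res_apply (homOfLE h) x hx a

lemma resO_resO {U V W : X.Opens} (h : V ≤ U) (h' : W ≤ V) (a : Γ(X, U)) :
    resO h' (resO h a) = resO (h'.trans h) a := by
  have := X.presheaf.map_comp (homOfLE h).op (homOfLE h').op
  exact (congrArg (fun f => f.hom a) this).symm

lemma eq_of_locally_eq {U : X.Opens} {a b : Γ(X, U)}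
    (h : ∀ x ∈ U, ∃ (V : X.Opens) (hV : V ≤ U), x ∈ V ∧ resO hV a = resO hV b) : a = b := by
  refine TopCat.Presheaf.section_ext X.sheaf U a b fun x hx => ?_
  obtain ⟨V, hV, hxV, hab⟩ := h x hx
  exact (resO_germ hV x hxV a).symm.trans
    ((congrArg (X.presheaf.germ V x hxV).hom hab).trans (resO_germ hV x hxV b))

lemma KSec.eq_of_locally_eq {U : X.Opens} {s t : KSec X U}
    (h : ∀ x ∈ U, ∃ (V : X.Opens) (hV : V ≤ U), x ∈ V ∧ resK hV s = resK hV t) : s = t := by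
  refine TopCat.Presheaf.section_ext (totalQuotientSheaf X) U s t fun x hx => ?_
  obtain ⟨V, hV, hxV, hab⟩ := h x hx
  exact (germK_resK hV x hxV s).symm.trans
    ((congrArg (germK V x hxV) hab).trans (germK_resK hV x hxV t))

lemma toTotalQuotientPresheaf_injective (U : X.Opens) :
    Function.Injective ((TopCat.Presheaf.toTotalQuotientPresheaf X.presheaf).app (op U)).hom := by
  have h : Mono (TopCat.Presheaf.toTotalQuotientPresheaf X.sheaf.presheaf) := inferInstance
  have h' : Mono ((TopCat.Presheaf.toTotalQuotientPresheaf X.sheaf.presheaf).app (op U)) :=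
    inferInstance
  exact (ConcreteCategory.mono_iff_injective_of_preservesPullback _).mp h'

/-- Sections identified by sheafification already agree locally in the presheaf of fractions, into
which `𝒪_X` injects because only nonzerodivisors are inverted. -/
lemma toK_injective (U : X.Opens) : Function.Injective (toK (X := X) U) := by
  intro a b hab
  refine eq_of_locally_eq fun x hx => ?_
  obtain ⟨V, f, hf, hxV⟩ := Presheaf.equalizerSieve_mem (Opens.grothendieckTopology X)
    (toSheafify (Opens.grothendieckTopology X) (TopCat.Presheaf.totalQuotientPresheaf X.presheaf))
    (((TopCat.Presheaf.toTotalQuotientPresheaf X.presheaf).app (op U)).hom a)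
    (((TopCat.Presheaf.toTotalQuotientPresheaf X.presheaf).app (op U)).hom b) hab x hx
  refine ⟨V, f.le, hxV, toTotalQuotientPresheaf_injective V ?_⟩
  have hnat := (TopCat.Presheaf.toTotalQuotientPresheaf X.presheaf).naturality f.op
  have hf' : ((TopCat.Presheaf.totalQuotientPresheaf X.presheaf).map f.op).hom
        (((TopCat.Presheaf.toTotalQuotientPresheaf X.presheaf).app (op U)).hom a) =
      ((TopCat.Presheaf.totalQuotientPresheaf X.presheaf).map f.op).hom
        (((TopCat.Presheaf.toTotalQuotientPresheaf X.presheaf).app (op U)).hom b) := hf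
  exact (congrArg (fun g => g.hom a) hnat).trans
    (hf'.trans (congrArg (fun g => g.hom b) hnat).symm)

lemma germK_toK (U : X.Opens) (x : X) (hx : x ∈ U) (a : Γ(X, U)) :
    germK U x hx (toK U a) = toKStalk x ((X.presheaf.germ U x hx).hom a) :=
  (TopCat.Presheaf.stalkFunctor_map_germ_apply U x hx (toTotalQuotientSheaf X) a).symm

lemma toKStalk_injective (x : X) : Function.Injective (toKStalk (X := X) x) :=
  TopCat.Presheaf.stalkFunctor_map_injective_of_app_injective
    (fun U => toK_injective U) x

lemma exists_toK_mul_eq (U : X.Opens) (s : KSec X U) (x : X) (hx : x ∈ U) :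
    ∃ (V : X.Opens) (h : V ≤ U) (hxV : x ∈ V) (a b : Γ(X, V)),
      (X.presheaf.germ V x hxV).hom b ∈ nonZeroDivisors (X.presheaf.stalk x) ∧
        toK V b * resK h s = toK V a := by
  obtain ⟨V, f, ⟨q, hq⟩, hxV⟩ := Presheaf.imageSieve_mem (Opens.grothendieckTopology X)
    (toSheafify (Opens.grothendieckTopology X) (TopCat.Presheaf.totalQuotientPresheaf X.presheaf))
    s x hx
  let S := (TopCat.Presheaf.submonoidPresheafOfStalk X.presheaf
    fun x => nonZeroDivisors (X.presheaf.stalk x)).obj (op V)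
  change Localization S at q
  obtain ⟨⟨a, b⟩, hab⟩ := IsLocalization.surj (M := S) (S := Localization S) q
  have hb := Submonoid.mem_iInf.mp b.2 ⟨x, hxV⟩
  refine ⟨V, f.le, hxV, a, b, hb, ?_⟩
  let φ : Localization S →+* KSec X V := ((toSheafify (Opens.grothendieckTopology X)
    (TopCat.Presheaf.totalQuotientPresheaf X.presheaf)).app (op V)).hom
  have hs : resK f.le s = φ q := hq.symm
  have hφ : ∀ c, toK V c = φ (algebraMap Γ(X, V) (Localization S) c) := fun _ => rfl
  rw [hs, hφ, hφ, ← map_mul, mul_comm]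
  exact congrArg φ hab

/-- In a zero-dimensional local ring every nonunit is nilpotent, so nonzerodivisors are units and a
local fraction `a/b` already lies in the stalk of `𝒪_X`. -/
lemma toKStalk_surjective (x : X) (hx : ringKrullDim (X.presheaf.stalk x) = 0) :
    Function.Surjective (toKStalk (X := X) x) := by
  intro k
  obtain ⟨U, hxU, s, rfl⟩ := (totalQuotientSheaf X).presheaf.exists_germ_eq k
  obtain ⟨V, h, hxV, a, b, hb, hab⟩ := exists_toK_mul_eq U s x hxU
  have hdim : Ring.KrullDimLE 0 (X.presheaf.stalk x) := Ring.krullDimLE_iff.mpr hx.le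
  have hu : IsUnit ((X.presheaf.germ V x hxV).hom b) := by
    by_contra hnu
    obtain ⟨n, hn⟩ := ((Ring.krullDimLE_zero_and_isLocalRing_tfae
      (X.presheaf.stalk x)).out 0 2 rfl rfl |>.mp ⟨hdim, inferInstance⟩ _).mpr hnu
    exact one_ne_zero (((nonZeroDivisors _).pow_mem hb n).1 1 (by rw [hn, zero_mul]))
  obtain ⟨c, hc⟩ := hu.exists_left_inv
  refine ⟨c * (X.presheaf.germ V x hxV).hom a, ?_⟩
  have h1 : toKStalk x ((X.presheaf.germ V x hxV).hom b) * germK U x hxU s =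
      toKStalk x ((X.presheaf.germ V x hxV).hom a) := by
    rw [← germK_toK, ← germK_toK, ← hab, map_mul, germK_resK]
  rw [map_mul, ← h1, ← mul_assoc, ← map_mul, hc, map_one, one_mul]
  rfl

end Separation

/-! ### Ideal sheaves inside `𝒦_X` and their stalks -/

namespace KSubmodule

/-- A subsheaf of `𝒦_X` is determined by its sections over the affine open sets. -/
lemma ext_of_affineOpens {I J : KSubmodule X} (h : ∀ U : X.affineOpens, I.sec U.1 = J.sec U.1) :
    I = J := by
  have key : ∀ {I J : KSubmodule X}, (∀ U : X.affineOpens, I.sec U.1 = J.sec U.1) →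
      ∀ U, I.sec U ≤ J.sec U := by
    intro I J h U s hs
    refine J.mem_of_locally s fun x hx => ?_
    obtain ⟨_, ⟨V, hV, rfl⟩, hxV, hVU⟩ := X.isBasis_affineOpens.exists_subset_of_mem_open hx U.2
    exact ⟨V, hVU, hxV, h ⟨V, hV⟩ ▸ I.res_mem hVU hs⟩
  exact KSubmodule.ext (funext fun U => le_antisymm (key h U) (key (fun U => (h U).symm) U))

/-- Local preimages in `𝒪_X` agree on overlaps by injectivity into `𝒦_X`, hence glue; `hloc` keeps
the glued section in `J`. -/
lemma mem_ofIdeals_sec_iff {J : ∀ U : X.Opens, Ideal Γ(X, U)}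
    {hJ : ∀ {U V : X.Opens} (h : V ≤ U) {a : Γ(X, U)}, a ∈ J U → resO h a ∈ J V}
    (hloc : ∀ (U : X.Opens) (a : Γ(X, U)),
      (∀ x ∈ U, ∃ (V : X.Opens) (h : V ≤ U), x ∈ V ∧ resO h a ∈ J V) → a ∈ J U)
    {U : X.Opens} {s : KSec X U} : s ∈ (ofIdeals J hJ).sec U ↔ ∃ a ∈ J U, toK U a = s := by
  constructor
  · intro hs
    choose V hV hxV a ha has using fun x : U => hs x.1 x.2
    obtain ⟨b, hb⟩ : ∃ b : Γ(X, U), ∀ x, resO (hV x) b = a x := by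
      refine (TopCat.Sheaf.existsUnique_gluing' X.sheaf V U (fun x => homOfLE (hV x))
        (fun x hx => Opens.mem_iSup.mpr ⟨⟨x, hx⟩, hxV _⟩) a fun x y => ?_).exists
      refine toK_injective _ ?_
      change toK _ (resO inf_le_left _) = toK _ (resO inf_le_right _)
      rw [← resK_toK, ← resK_toK, has, has, resK_resK, resK_resK]
    refine ⟨b, hloc U b fun x hx => ⟨V ⟨x, hx⟩, hV _, hxV _, ?_⟩, ?_⟩
    · rw [hb]
      exact ha _
    · refine KSec.eq_of_locally_eq fun x hx => ⟨V ⟨x, hx⟩, hV _, hxV _, ?_⟩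
      rw [resK_toK, hb, has]
  · rintro ⟨a, ha, rfl⟩ x hx
    exact ⟨U, le_rfl, hx, resO le_rfl a, hJ _ ha, (resK_toK _ _).symm⟩

lemma mem_structureSheaf_sec_iff {U : X.Opens} {s : KSec X U} :
    s ∈ (structureSheaf X).sec U ↔ ∃ a, toK U a = s := by
  unfold structureSheaf
  rw [mem_ofIdeals_sec_iff (hJ := fun _ _ _ => Submodule.mem_top) fun _ _ _ => Submodule.mem_top]
  simp

lemma resO_app {Y : Scheme.{u}} (i : Y ⟶ X) {U V : X.Opens} (h : V ≤ U) (a : Γ(X, U)) :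
    (i.app V).hom (resO h a) =
      resO (show i ⁻¹ᵁ V ≤ i ⁻¹ᵁ U from fun _ hx => h hx) ((i.app U).hom a) := by
  have := i.naturality (homOfLE h).op
  exact congrArg (fun f => f.hom a) this

lemma ker_app_res {Y : Scheme.{u}} (i : Y ⟶ X) {U V : X.Opens} (h : V ≤ U) {a : Γ(X, U)}
    (ha : a ∈ RingHom.ker (i.app U).hom) : resO h a ∈ RingHom.ker (i.app V).hom := by
  rw [RingHom.mem_ker] at ha ⊢
  rw [resO_app, ha, map_zero]

lemma mem_ofHom_sec_iff {Y : Scheme.{u}} (i : Y ⟶ X) {U : X.Opens} {s : KSec X U} :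
    s ∈ (ofHom i).sec U ↔ ∃ a, (i.app U).hom a = 0 ∧ toK U a = s := by
  unfold ofHom
  refine mem_ofIdeals_sec_iff (hJ := ker_app_res i) fun U a h => ?_
  rw [RingHom.mem_ker]
  refine eq_of_locally_eq fun y hy => ?_
  obtain ⟨V, hV, hyV, hVa⟩ := h (i y) hy
  refine ⟨i ⁻¹ᵁ V, fun _ hx => hV hx, hyV, ?_⟩
  rw [map_zero, ← resO_app i hV, RingHom.mem_ker.mp hVa]

lemma isEffective_ofHom {Y : Scheme.{u}} (i : Y ⟶ X) : (ofHom i).IsEffective := by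
  intro U s hs
  obtain ⟨a, -, rfl⟩ := (mem_ofHom_sec_iff i).mp hs
  exact mem_structureSheaf_sec_iff.mpr ⟨a, rfl⟩

lemma ofHom_sec_eq_map {Y : Scheme.{u}} (i : Y ⟶ X) (U : X.Opens) :
    (ofHom i).sec U =
      Submodule.map (Algebra.linearMap Γ(X, U) (KSec X U)) (RingHom.ker (i.app U).hom) := by
  ext s
  exact mem_ofHom_sec_iff i

lemma isCoherent_ofHom [IsLocallyNoetherian X] {Y : Scheme.{u}} (i : Y ⟶ X) [QuasiCompact i] :
    (ofHom i).IsCoherent where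
  finite U := by
    have := IsLocallyNoetherian.component_noetherian U
    rw [ofHom_sec_eq_map]
    exact Module.Finite.iff_fg.mpr ((IsNoetherian.noetherian (RingHom.ker (i.app U.1).hom)).map _)
  exists_of_basicOpen U f s hs := by
    obtain ⟨a, ha, rfl⟩ := (mem_ofHom_sec_iff i).mp hs
    have hmem : a ∈ i.ker.ideal (X.affineBasicOpen f) := by
      rw [Scheme.Hom.ker_apply]
      exact ha
    -- Quasi-compactness of `i` enters through `i.ker`: the kernel on `D(f)` is the localization of
    -- the kernel on `U`.
    rw [← Scheme.IdealSheafData.map_ideal_basicOpen] at hmem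
    have := U.2.isLocalization_basicOpen f
    obtain ⟨⟨⟨b, hb⟩, ⟨_, n, rfl⟩⟩, hbn⟩ :=
      (IsLocalization.mem_map_algebraMap_iff (.powers f) Γ(X, X.basicOpen f)).mp hmem
    rw [Scheme.Hom.ker_apply] at hb
    refine ⟨n, toK U.1 b, (mem_ofHom_sec_iff i).mpr ⟨b, hb, rfl⟩, ?_⟩
    have hbn' : a * resO (X.basicOpen_le f) (f ^ n) = resO (X.basicOpen_le f) b := hbn
    rw [resK_toK, ← hbn', mul_comm, map_mul, map_pow, Algebra.smul_def]
    rfl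
  eq_zero_of_basicOpen U f t ht h := by
    obtain ⟨a, ha, rfl⟩ := (mem_ofHom_sec_iff i).mp ht
    rw [resK_toK] at h
    have h0 : resO (X.basicOpen_le f) a = 0 := toK_injective _ (h.trans (map_zero _).symm)
    have := U.2.isLocalization_basicOpen f
    obtain ⟨⟨_, n, rfl⟩, hn⟩ :=
      (IsLocalization.map_eq_zero_iff (.powers f) Γ(X, X.basicOpen f) a).mp h0
    refine ⟨n, ?_⟩
    rw [Algebra.smul_def]
    change toK U.1 _ * _ = 0
    rw [← map_mul, hn, map_zero]

/-- The ideal of sections of `𝒪_X` lying in `ℐ`. -/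
noncomputable def idealSec (I : KSubmodule X) (U : X.Opens) : Ideal Γ(X, U) :=
  (I.sec U).comap (Algebra.linearMap Γ(X, U) (KSec X U))

/-- The ideal sheaf data of an effective coherent submodule of `𝒦_X`. -/
noncomputable def idealSheafData (I : KSubmodule X) (hI : I.IsCoherent) (hI' : I.IsEffective) :
    X.IdealSheafData where
  ideal U := I.idealSec U.1
  map_ideal_basicOpen U f := by
    refine le_antisymm (Ideal.map_le_iff_le_comap.mpr fun a ha => ?_) fun b hb => ?_
    · have hres := I.res_mem (X.basicOpen_le f) ha
      exact (congrArg (· ∈ I.sec (X.basicOpen f)) (resK_toK (X.basicOpen_le f) a)).mp hres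
    · change Γ(X, X.basicOpen f) at b
      replace hb : toK (X.basicOpen f) b ∈ I.sec (X.basicOpen f) := hb
      obtain ⟨n, t, ht, htb⟩ := hI.exists_of_basicOpen U f _ hb
      obtain ⟨a, rfl⟩ := mem_structureSheaf_sec_iff.mp (hI' U.1 ht)
      have := U.2.isLocalization_basicOpen f
      have hab : resO (X.basicOpen_le f) a = b * resO (X.basicOpen_le f) (f ^ n) := by
        refine toK_injective _ ?_
        rw [← resK_toK, htb, Algebra.smul_def, mul_comm b, map_mul, map_pow (resO _)]
        rfl
      exact (IsLocalization.mem_map_algebraMap_iff (.powers f) Γ(X, X.basicOpen f)).mpr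
        ⟨⟨⟨a, ht⟩, ⟨_, n, rfl⟩⟩, hab.symm⟩

lemma ofHom_subschemeι_idealSheafData (I : KSubmodule X) (hI : I.IsCoherent)
    (hI' : I.IsEffective) : ofHom (I.idealSheafData hI hI').subschemeι = I := by
  refine ext_of_affineOpens fun U => ?_
  ext s
  have hker : ∀ a : Γ(X, U.1), ((I.idealSheafData hI hI').subschemeι.app U.1).hom a = 0 ↔
      toK U.1 a ∈ I.sec U.1 := by
    intro a
    rw [← RingHom.mem_ker, Scheme.IdealSheafData.ker_subschemeι_app]
    rfl
  rw [mem_ofHom_sec_iff]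
  constructor
  · rintro ⟨a, ha, rfl⟩
    exact (hker a).mp ha
  · intro hs
    obtain ⟨a, rfl⟩ := mem_structureSheaf_sec_iff.mp (hI' U.1 hs)
    exact ⟨a, (hker a).mpr hs, rfl⟩

lemma ker_eq_of_ofHom_eq {Y Z : Scheme.{u}} (i : Y ⟶ X) (j : Z ⟶ X) [QuasiCompact i]
    [QuasiCompact j] (h : ofHom i = ofHom j) : i.ker = j.ker := by
  have key : ∀ {Y Z : Scheme.{u}} (i : Y ⟶ X) (j : Z ⟶ X) [QuasiCompact i] [QuasiCompact j],
      ofHom i = ofHom j → i.ker ≤ j.ker := by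
    intro Y Z i j _ _ h U a ha
    rw [Scheme.Hom.ker_apply] at ha ⊢
    have hmem : toK U.1 a ∈ (ofHom j).sec U.1 := h ▸ (mem_ofHom_sec_iff i).mpr ⟨a, ha, rfl⟩
    obtain ⟨b, hb, hba⟩ := (mem_ofHom_sec_iff j).mp hmem
    rwa [toK_injective _ hba] at hb
  exact le_antisymm (key i j h) (key j i h.symm)

/-- The ideal of `𝒪_{X,x}` of the elements lying in `ℐ_x`. -/
noncomputable def idealStalk (I : KSubmodule X) (x : X) : Ideal (X.presheaf.stalk x) :=
  (I.stalk x).comap (Algebra.linearMap (X.presheaf.stalk x) (KStalk X x))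

lemma mem_idealStalk_iff {I : KSubmodule X} {x : X} {t : X.presheaf.stalk x} :
    t ∈ I.idealStalk x ↔ toKStalk x t ∈ I.stalk x := Iff.rfl

lemma IsEffective.stalk_le_range {I : KSubmodule X} (hI : I.IsEffective) (x : X) :
    I.stalk x ≤ LinearMap.range (Algebra.linearMap (X.presheaf.stalk x) (KStalk X x)) := by
  rintro _ ⟨U, hx, s, hs, rfl⟩
  obtain ⟨a, rfl⟩ := mem_structureSheaf_sec_iff.mp (hI U hs)
  exact ⟨(X.presheaf.germ U x hx).hom a, (germK_toK U x hx a).symm⟩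

/-- For `ℐ ⊆ 𝒪_X`, the stalk `ℐ_x` is an ideal of `𝒪_{X,x}`. -/
noncomputable def idealStalkEquiv {I : KSubmodule X} (hI : I.IsEffective) (x : X) :
    I.idealStalk x ≃ₗ[X.presheaf.stalk x] I.stalk x :=
  (Submodule.equivMapOfInjective (Algebra.linearMap (X.presheaf.stalk x) (KStalk X x))
    (toKStalk_injective x) _).trans
      (LinearEquiv.ofEq _ _ (Submodule.map_comap_eq_of_le (hI.stalk_le_range x)))

lemma mem_idealStalk_ofHom_iff {Y : Scheme.{u}} (i : Y ⟶ X) {x : X} {t : X.presheaf.stalk x} :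
    t ∈ (ofHom i).idealStalk x ↔ ∃ (U : X.Opens) (hx : x ∈ U) (a : Γ(X, U)),
      (i.app U).hom a = 0 ∧ (X.presheaf.germ U x hx).hom a = t := by
  rw [mem_idealStalk_iff]
  constructor
  · rintro ⟨U, hx, s, hs, hst⟩
    obtain ⟨a, ha, rfl⟩ := (mem_ofHom_sec_iff i).mp hs
    exact ⟨U, hx, a, ha, toKStalk_injective x ((germK_toK U x hx a).symm.trans hst)⟩
  · rintro ⟨U, hx, a, ha, rfl⟩
    exact ⟨U, hx, _, (mem_ofHom_sec_iff i).mpr ⟨a, ha, rfl⟩, germK_toK U x hx a⟩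

lemma idealStalk_ofHom_eq_ker {Y : Scheme.{u}} (i : Y ⟶ X) (hi : Topology.IsInducing i) (y : Y) :
    (ofHom i).idealStalk (i y) = RingHom.ker (i.stalkMap y).hom := by
  ext t
  rw [mem_idealStalk_ofHom_iff, RingHom.mem_ker]
  constructor
  · rintro ⟨U, hx, a, ha, rfl⟩
    refine (Scheme.Hom.germ_stalkMap_apply i U y hx a).trans ?_
    exact (congrArg _ ha).trans (map_zero (Y.presheaf.germ (i ⁻¹ᵁ U) y hx).hom)
  · intro ht
    obtain ⟨U, hx, a, rfl⟩ := X.presheaf.exists_germ_eq t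
    have h0 : (Y.presheaf.germ (i ⁻¹ᵁ U) y hx).hom ((i.app U).hom a) =
        (Y.presheaf.germ (i ⁻¹ᵁ U) y hx).hom 0 := by
      rw [map_zero]
      exact (Scheme.Hom.germ_stalkMap_apply i U y hx a).symm.trans ht
    obtain ⟨W, hyW, h₁, h₂, hW⟩ := Y.presheaf.germ_eq y hx hx _ _ h0
    -- The pulled-back section vanishes only on an open `W` of `Y`; the induced topology makes `W` a
    -- preimage, so the shrinking can be done on `X`.
    obtain ⟨V, hV, hVW⟩ := hi.isOpen_iff.mp W.2
    have hyV : i y ∈ V := by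
      have : y ∈ i ⁻¹' V := hVW ▸ hyW
      exact this
    let V' : X.Opens := U ⊓ ⟨V, hV⟩
    refine ⟨V', ⟨hx, hyV⟩, resO inf_le_left a, ?_, resO_germ _ _ _ _⟩
    have hle : i ⁻¹ᵁ V' ≤ W := fun z hz => by
      have : z ∈ i ⁻¹' V := hz.2
      rw [hVW] at this
      exact this
    have hWa : resO h₁.le ((i.app U).hom a) = 0 := hW.trans (map_zero _)
    rw [resO_app, ← resO_resO h₁.le hle, hWa, map_zero]

lemma idealStalk_ofHom_eq_top {Y : Scheme.{u}} (i : Y ⟶ X) (hi : IsClosed (Set.range i)) {x : X}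
    (hx : x ∉ Set.range i) : (ofHom i).idealStalk x = ⊤ := by
  rw [Ideal.eq_top_iff_one, mem_idealStalk_ofHom_iff]
  refine ⟨⟨(Set.range i)ᶜ, hi.isOpen_compl⟩, hx, 1, ?_, map_one _⟩
  -- The preimage of the complement of the image is empty, so `1 = 0` there.
  refine eq_of_locally_eq fun y hy => (hy ⟨y, rfl⟩).elim

end KSubmodule

/-! ### Generic points as points of codimension zero -/

section GenericPoints

lemma mem_genericPoints_iff {T : Type*} [TopologicalSpace T] [QuasiSober T] [T0Space T] (x : T) :
    x ∈ genericPoints T ↔ ∀ z, z ⤳ x → z = x := by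
  change Maximal IsIrreducible (closure {x}) ↔ _
  constructor
  · intro h z hz
    have hle : closure {x} ⊆ closure {z} := specializes_iff_closure_subset.mp hz
    have := h.2 isIrreducible_singleton.closure hle
    exact (hz.antisymm (specializes_iff_closure_subset.mpr this)).eq
  · intro h
    refine ⟨isIrreducible_singleton.closure, fun Z hZ hle => ?_⟩
    obtain ⟨z, hz⟩ := QuasiSober.sober hZ.closure isClosed_closure
    have hzx : z ⤳ x := hz.specializes (subset_closure (hle (subset_closure rfl)))
    obtain rfl := h z hzx
    rw [hz.def]
    exact subset_closure

variable {X : Scheme.{u}}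

lemma coheight_eq_zero_iff (x : X) : Order.coheight x = 0 ↔ x ∈ genericPoints X := by
  rw [Order.coheight_eq_zero, mem_genericPoints_iff]
  constructor
  · intro h z hz
    have hxz : x ⤳ z := h (show x ≤ z from hz)
    exact (hz.antisymm hxz).eq
  · intro h z hz
    have hzx : z = x := h z hz
    exact hzx.le

lemma ringKrullDim_stalk_eq_zero_iff (x : X) :
    ringKrullDim (X.presheaf.stalk x) = 0 ↔ x ∈ genericPoints X := by
  rw [ringKrullDim_stalk_eq_coheight, ← coheight_eq_zero_iff]
  norm_cast

lemma coheight_eq_zero_of_specializes {z x : X} (h : z ⤳ x) (hne : z ≠ x)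
    (hx : Order.coheight x = 1) : Order.coheight z = 0 := by
  have hlt : x < z := lt_of_le_not_ge h fun h' => hne (h.antisymm h').eq
  have h1 := Order.coheight_add_one_le hlt
  rw [hx] at h1
  have h2 : Order.coheight z ≤ 0 := by
    rw [← zero_add (1 : ℕ∞)] at h1
    exact (ENat.add_le_add_iff_right ENat.one_ne_top).mp h1
  exact le_antisymm h2 zero_le

end GenericPoints

/-! ### Associated points of a closed subscheme and the `S_2` condition -/

section ClosedImmersion

variable {X Y : Scheme.{u}}

lemma isNoetherianRing_stalk_of_isClosedImmersion (i : Y ⟶ X) [IsClosedImmersion i]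
    [IsLocallyNoetherian X] (y : Y) :
    IsNoetherianRing (Y.presheaf.stalk y) :=
  isNoetherianRing_of_surjective _ _ (i.stalkMap y).hom (i.stalkMap_surjective y)

/-- Moves the question from `𝒪_{Y,y}` to the ideal in `𝒪_{X,i y}`, where the depth criteria apply.
-/
lemma isAssociatedPoint_iff (i : Y ⟶ X) [IsClosedImmersion i] [IsLocallyNoetherian X] (y : Y) :
    IsAssociatedPoint Y y ↔ ∃ e ∉ (KSubmodule.ofHom i).idealStalk (i y),
      ∀ t ∈ IsLocalRing.maximalIdeal (X.presheaf.stalk (i y)),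
        t * e ∈ (KSubmodule.ofHom i).idealStalk (i y) := by
  have := isNoetherianRing_stalk_of_isClosedImmersion i y
  rw [KSubmodule.idealStalk_ofHom_eq_ker i i.isClosedEmbedding.isInducing]
  exact isAssociatedPrime_maximalIdeal_iff_of_surjective (i.stalkMap y).hom
    (i.stalkMap_surjective y)

lemma isAssociatedPoint_of_mem_genericPoints (i : Y ⟶ X) [IsClosedImmersion i]
    [IsLocallyNoetherian X] {y : Y}
    (hy : y ∈ genericPoints Y) : IsAssociatedPoint Y y := by
  have := isNoetherianRing_stalk_of_isClosedImmersion i y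
  exact isAssociatedPrime_maximalIdeal_of_dim_zero
    (Ring.krullDimLE_iff.mpr ((ringKrullDim_stalk_eq_zero_iff y).mpr hy).le)

lemma mem_genericPoints_of_map_mem (i : Y ⟶ X) [IsClosedImmersion i]
    {y : Y} (h : i y ∈ genericPoints X) : y ∈ genericPoints Y := by
  rw [mem_genericPoints_iff] at h ⊢
  exact fun z hz => i.isClosedEmbedding.injective (h _ (hz.map i.continuous))

/-- A nondegenerate ideal sheaf defines a closed subscheme which contains no generic point of the
ambient scheme. -/
lemma map_notMem_genericPoints (i : Y ⟶ X) [IsClosedImmersion i]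
    (h : (KSubmodule.ofHom i).IsNondegenerate) (y : Y) :
    i y ∉ genericPoints X := by
  intro hy
  have h1 : (1 : X.presheaf.stalk (i y)) ∈ (KSubmodule.ofHom i).idealStalk (i y) := by
    rw [KSubmodule.mem_idealStalk_iff, h _ hy]
    trivial
  rw [KSubmodule.idealStalk_ofHom_eq_ker i i.isClosedEmbedding.isInducing, RingHom.mem_ker,
    map_one] at h1
  exact one_ne_zero h1

lemma isNondegenerate_ofHom (i : Y ⟶ X) [IsClosedImmersion i]
    (h : ∀ y, i y ∉ genericPoints X) :
    (KSubmodule.ofHom i).IsNondegenerate := by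
  intro η hη
  have htop := KSubmodule.idealStalk_ofHom_eq_top i i.isClosedEmbedding.isClosed_range (x := η)
    (by rintro ⟨y, rfl⟩; exact h y hη)
  refine eq_top_iff.mpr fun k _ => ?_
  obtain ⟨t, rfl⟩ := toKStalk_surjective η ((ringKrullDim_stalk_eq_zero_iff η).mpr hη) k
  exact KSubmodule.mem_idealStalk_iff.mp (htop ▸ Submodule.mem_top)

lemma satisfiesSerre_ofHom_iff (i : Y ⟶ X) : (KSubmodule.ofHom i).SatisfiesSerre 2 ↔
    ∀ x : X, (1 ≤ Order.coheight x →
        1 ≤ depth (X.presheaf.stalk x) ((KSubmodule.ofHom i).idealStalk x)) ∧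
      (2 ≤ Order.coheight x →
        2 ≤ depth (X.presheaf.stalk x) ((KSubmodule.ofHom i).idealStalk x)) := by
  refine forall_congr' fun x => ?_
  rw [← depthGeMin_two_of_dim_eq _ (ringKrullDim_stalk_eq_coheight x)]
  exact (depthGeMin_congr 2
    (KSubmodule.idealStalkEquiv (KSubmodule.isEffective_ofHom i) x)).symm

lemma SatisfiesSerre.depth (hX : SatisfiesSerre X 2) (x : X) :
    (1 ≤ Order.coheight x → 1 ≤ depth (X.presheaf.stalk x) (X.presheaf.stalk x)) ∧
      (2 ≤ Order.coheight x → 2 ≤ GenDiv.depth (X.presheaf.stalk x) (X.presheaf.stalk x)) :=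
  (depthGeMin_two_of_dim_eq _ (ringKrullDim_stalk_eq_coheight x)).mp (hX x)

variable {i : Y ⟶ X} [IsClosedImmersion i]

/-- Nondegeneracy excludes codimension 0. In codimension at least 2, the ideal has depth at least 2,
which leaves no nonzero class killed by the maximal ideal. -/
lemma coheight_map_eq_one_of_isAssociatedPoint [IsLocallyNoetherian X] (hX : SatisfiesSerre X 2)
    (hnd : (KSubmodule.ofHom i).IsNondegenerate) (hS : (KSubmodule.ofHom i).SatisfiesSerre 2)
    {y : Y} (hy : IsAssociatedPoint Y y) : Order.coheight (i y) = 1 := by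
  have h1 : 1 ≤ Order.coheight (i y) :=
    Order.one_le_iff_ne_zero.mpr fun h0 =>
      map_notMem_genericPoints i hnd y ((coheight_eq_zero_iff _).mp h0)
  refine le_antisymm (not_lt.mp fun hlt => ?_) h1
  have h2 : 2 ≤ Order.coheight (i y) := by
    have := Order.add_one_le_of_lt hlt
    rwa [one_add_one_eq_two] at this
  obtain ⟨e, he, hme⟩ := (isAssociatedPoint_iff i y).mp hy
  exact he (mem_of_two_le_depth ((hX.depth (i y)).1 h1)
    (((satisfiesSerre_ofHom_iff i).mp hS (i y)).2 h2) e hme)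

/-- The closed subscheme defined by an effective generalized divisor is of pure codimension one and
has no embedded points. -/
lemma isPureCodimOne_and_hasNoEmbeddedPoints [IsLocallyNoetherian X] (hX : SatisfiesSerre X 2)
    (hnd : (KSubmodule.ofHom i).IsNondegenerate) (hS : (KSubmodule.ofHom i).SatisfiesSerre 2) :
    IsPureCodimOne i ∧ HasNoEmbeddedPoints Y := by
  refine ⟨fun y hy => coheight_map_eq_one_of_isAssociatedPoint hX hnd hS
    (isAssociatedPoint_of_mem_genericPoints i hy), fun y hy => ?_⟩
  rw [mem_genericPoints_iff]
  intro z hz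
  by_contra hne
  -- A proper generization of a codimension-one point has codimension 0 in `X`, yet `Y` contains no
  -- such point.
  refine map_notMem_genericPoints i hnd z ((coheight_eq_zero_iff _).mp ?_)
  exact coheight_eq_zero_of_specializes (hz.map i.continuous)
    (i.isClosedEmbedding.injective.ne hne)
    (coheight_map_eq_one_of_isAssociatedPoint hX hnd hS hy)

/-- The ideal sheaf of a closed subscheme of pure codimension one without embedded points is a
generalized divisor. -/
lemma isGeneralizedDivisor_ofHom [IsLocallyNoetherian X] (hX : SatisfiesSerre X 2)
    (hpure : IsPureCodimOne i) (hemb : HasNoEmbeddedPoints Y) :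
    (KSubmodule.ofHom i).IsGeneralizedDivisor := by
  refine ⟨KSubmodule.isCoherent_ofHom i, isNondegenerate_ofHom i fun y hy => ?_,
    (satisfiesSerre_ofHom_iff i).mpr fun x =>
      ⟨fun h1 => one_le_depth_ideal ((hX.depth x).1 h1) _,
        fun h2 => two_le_depth_ideal ((hX.depth x).2 h2) fun e he => ?_⟩⟩
  · have h1 := hpure y (mem_genericPoints_of_map_mem i hy)
    rw [(coheight_eq_zero_iff _).mpr hy] at h1
    exact zero_ne_one h1
  · by_contra hcon
    -- On `Y`, such an `e` makes the point associated, hence generic in `Y` and of codimension 1;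
    -- off `Y` the ideal is the unit ideal.
    by_cases hx : x ∈ Set.range i
    · obtain ⟨y, rfl⟩ := hx
      rw [hpure y (hemb y ((isAssociatedPoint_iff i y).mpr ⟨e, hcon, he⟩))] at h2
      exact absurd h2 (by norm_num)
    · rw [KSubmodule.idealStalk_ofHom_eq_top i i.isClosedEmbedding.isClosed_range hx] at hcon
      exact hcon Submodule.mem_top

end ClosedImmersion

/-! ### Conclusion: the correspondence is bijective -/

lemma ClosedSubscheme.idealSheaf_injective (X : Scheme.{u}) :
    Function.Injective (ClosedSubscheme.idealSheaf (X := X)) := by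
  rintro ⟨Y⟩ ⟨Z⟩ h
  have := Y.isClosedImmersion
  have := Z.isClosedImmersion
  have hker : Z.hom.ker = Y.hom.ker := (KSubmodule.ker_eq_of_ofHom_eq Y.hom Z.hom h).symm
  have := IsClosedImmersion.isIso_lift Z.hom Y.hom hker
  exact _root_.Quotient.sound ⟨asIso (IsClosedImmersion.lift Z.hom Y.hom hker.le),
    IsClosedImmersion.lift_fac _ _ _⟩

end GenDiv

theorem proposition2p1 (X : Scheme.{u}) [IsNoetherian X] (hX : GenDiv.SatisfiesSerre X 2) :
    Set.BijOn (GenDiv.ClosedSubscheme.idealSheaf (X := X))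
      {Y | Y.IsPureCodimOneNoEmbedded}
      {I | I.IsGeneralizedDivisor ∧ I.IsEffective} := by
  refine ⟨?_, (GenDiv.ClosedSubscheme.idealSheaf_injective X).injOn, ?_⟩
  · rintro _ ⟨Z, rfl, hpure, hemb⟩
    have := Z.isClosedImmersion
    exact ⟨GenDiv.isGeneralizedDivisor_ofHom hX hpure hemb,
      GenDiv.KSubmodule.isEffective_ofHom Z.hom⟩
  · rintro I ⟨hI, heff⟩
    let Z : GenDiv.ClosedImmersionInto X :=
      ⟨_, (I.idealSheafData hI.coherent heff).subschemeι, inferInstance⟩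
    have hZ : GenDiv.KSubmodule.ofHom Z.hom = I :=
      I.ofHom_subschemeι_idealSheafData hI.coherent heff
    have := Z.isClosedImmersion
    refine ⟨_root_.Quotient.mk _ Z, ⟨Z, rfl, ?_⟩, hZ⟩
    exact GenDiv.isPureCodimOne_and_hasNoEmbeddedPoints hX (hZ ▸ hI.nondegenerate)
      (hZ ▸ hI.serre)
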